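/- A generalized non-crossing tree (GNC-tree) on $n+1$ points ($n\ge 0$) is a tree whose vertices are $n+1$ points on a circle, listed in counterclockwise order starting from a distinguished point, the root, such that its edges, drawn as chords, do not cross, together with a labelling of the points by positive integers which is weakly increasing in this order and such that, whenever $j$ is a label, all of $1,\dots,j$ are labels (so the root is the first point labelled $1$). Let $\mathsf{GNC}_n$ be the set of these trees. An edge $(v,w)$ of such a tree, with $v$ on the path from the root to $w$, is an ascent, a level or a descent ($u$, $h$ or $d$) according as the label of $v$ is less than, equal to or greater than that of $w$; let $u(T),h(T),d(T)$ be the numbers of ascents, levels and descents of $T$. A GNC-tree is $d$-avoiding if no path starting at the root contains a descent; let $\mathsf{GNC}_n(d)$ be the set of $d$-avoiding trees in $\mathsf{GNC}_n$. Let $C_i=\frac1{i+1}\binom{2i}{i}$, $C(t)=\sum_{i\ge0}C_it^i$ and $$T_{x,y,z}(t)=\sum_{n\ge 0}t^n\sum_{T\in\mathsf{GNC}_n}x^{u(T)}y^{h(T)}z^{d(T)}$$ (with $0^0=1$). Theorem. As formal power series, $T_{1,1,0}(t)=C\bigl(2t\,T_{0,1,0}(t)\bigr)$, and for every $n\ge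 0$ $$|\mathsf{GNC}_n(d)|=\sum_{\substack{i+j=n\\ i,j\ge 0}}\frac{i}{3j+i}\binom{3j+i}{j}2^iC_i,$$ where the factor $\frac{i}{3j+i}$ is read as $1$ when $i=j=0$. -/

import Mathlib

/-- A rooted generalized non-crossing tree on `n + 1` points.  The points of the circle, listed in
counterclockwise order starting from the root, are `0, 1, …, n : Fin (n + 1)`; the root `0` is the
first point labelled `1`.  The tree is non-crossing, the labels are positive integers that weakly
increase in counterclockwise order, and with a label `j` all of `1, …, j` are labels. -/
@[ext]
structure GNCTree (n : ℕ) where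
  graph : SimpleGraph (Fin (n + 1))
  isTree : graph.IsTree
  /-- no two chords `{a, c}` and `{b, d}` with `a < b < c < d` -/
  nonCrossing : ∀ a b c d : Fin (n + 1), a < b → b < c → c < d →
    graph.Adj a c → ¬ graph.Adj b d
  label : Fin (n + 1) → ℕ
  label_pos : ∀ v, 1 ≤ label v
  label_mono : Monotone label
  label_initial : ∀ v i, 1 ≤ i → i ≤ label v → ∃ w, label w = i

/-- The letters `u` (ascent), `h` (level) and `d` (descent). -/
inductive GNCStep where
  | u
  | h
  | d

/-- The letter of an edge traversed from a point labelled `i` to a point labelled `j`. -/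
def GNCStep.ofLabels (i j : ℕ) : GNCStep :=
  if i < j then GNCStep.u else if i = j then GNCStep.h else GNCStep.d

namespace GNCTree

variable {n : ℕ}

/-- The ternary word of a walk in the tree. -/
def word (T : GNCTree n) {v w : Fin (n + 1)} (p : T.graph.Walk v w) : List GNCStep :=
  p.darts.map fun e => GNCStep.ofLabels (T.label e.fst) (T.label e.snd)

/-- `T` avoids `σ` if `σ` is not a block of consecutive letters of the word of any path that
starts at the root. -/
def Avoids (T : GNCTree n) (σ : List GNCStep) : Prop :=
  ∀ (v : Fin (n + 1)) (p : T.graph.Walk 0 v), p.IsPath → ¬ σ <:+: T.word p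

/-- `(v, w)` is an edge and `v` is on the path from the root to `w`. -/
def IsDownEdge (T : GNCTree n) (v w : Fin (n + 1)) : Prop :=
  T.graph.Adj v w ∧ ∃ p : T.graph.Walk 0 w, p.IsPath ∧ v ∈ p.support

/-- The number of ascents. -/
noncomputable def ascents (T : GNCTree n) : ℕ :=
  Set.ncard {e : Fin (n + 1) × Fin (n + 1) | T.IsDownEdge e.1 e.2 ∧ T.label e.1 < T.label e.2}

/-- The number of levels. -/
noncomputable def levels (T : GNCTree n) : ℕ :=
  Set.ncard {e : Fin (n + 1) × Fin (n + 1) | T.IsDownEdge e.1 e.2 ∧ T.label e.1 = T.label e.2}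

/-- The number of descents. -/
noncomputable def descents (T : GNCTree n) : ℕ :=
  Set.ncard {e : Fin (n + 1) × Fin (n + 1) | T.IsDownEdge e.1 e.2 ∧ T.label e.2 < T.label e.1}

theorem label_le (T : GNCTree n) (v : Fin (n + 1)) : T.label v ≤ n + 1 := by
  classical
  have h : Finset.Icc 1 (T.label v) ⊆ Finset.univ.image T.label := by
    intro i hi
    rw [Finset.mem_Icc] at hi
    obtain ⟨w, hw⟩ := T.label_initial v i hi.1 hi.2
    exact Finset.mem_image.2 ⟨w, Finset.mem_univ _, hw⟩
  have h1 := (Finset.card_le_card h).trans Finset.card_image_le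
  simpa using h1

instance instFinite (n : ℕ) : Finite (GNCTree n) := by
  classical
  let f : GNCTree n → SimpleGraph (Fin (n + 1)) × (Fin (n + 1) → Fin (n + 2)) := fun T =>
    (T.graph, fun v => ⟨T.label v, Nat.lt_succ_of_le (T.label_le v)⟩)
  refine Finite.of_injective f ?_
  intro S T hST
  have h1 : S.graph = T.graph := congrArg Prod.fst hST
  have h2 := congrArg Prod.snd hST
  refine GNCTree.ext h1 (funext fun v => ?_)
  have h3 := congrArg Fin.val (congrFun h2 v)
  exact h3

noncomputable instance instFintype (n : ℕ) : Fintype (GNCTree n) := Fintype.ofFinite _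

/-- `T_{x,y,z}(t) = ∑ₙ tⁿ ∑_T x^{u(T)} y^{h(T)} z^{d(T)}`, with `0 ^ 0 = 1`. -/
noncomputable def genFun (x y z : ℤ) : PowerSeries ℤ :=
  PowerSeries.mk fun n => ∑ T : GNCTree n, x ^ T.ascents * y ^ T.levels * z ^ T.descents

end GNCTree

/-- The generating function `C(t)` of the Catalan numbers. -/
noncomputable def catalanGenFun : PowerSeries ℤ :=
  PowerSeries.catalanSeries.map (Nat.castRingHom ℤ)

/-! ### The series `N = 1 + X * N ^ 3` and its composition with the Catalan series. -/

section PowerSeriesLemmas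

open PowerSeries

/-! A non-crossing tree on an interval [a, b] splits at its longest chord (a, c) at a into trees on
[a, q], [q + 1, c] and [c, b]. Iterating this encodes it by a ternary tree
(`IsChordTree.exists_ternaryTree`, `TernaryTree.edges_injective`). A labelling is determined by the
set of gaps (i, i + 1) where it rises. Every path from a into the middle piece enters it at its
largest point c and moves on to smaller points, so without descents the labels on [q + 1, c] are
constant. The gap (q, q + 1) is unconstrained, and the outer pieces are entered at their left ends,
so they recurse. Hence the descent-free labellings are exactly the subsets of `freeGaps`
(`TernaryTree.forall_risingReach_iff`), and there are 2 ^ rank of them. With R_x the series of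
ternary trees weighted by x ^ rank, R_x = 1 + x t R_x² R_1 (`TernaryTree.rankGenFun_eq`). Constant
labellings give T_{0,1,0} = R_1 = N with N = 1 + t N³, and T_{1,1,0} = R_2 solves D = 1 + 2tN D², so
D = C(2tN). Expanding in powers of tN gives the coefficients. -/

theorem coeff_pow_of_eq_one_add_X_mul_cube {N : ℤ⟦X⟧} (hN : N = 1 + X * N ^ 3) (i j : ℕ) :
    ((coeff j (N ^ i) : ℤ) : ℚ) =
      (if i = 0 ∧ j = 0 then (1 : ℚ) else (i : ℚ) / (3 * (j : ℚ) + (i : ℚ)))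
        * (Nat.choose (3 * j + i) j : ℚ) := by
  have h0 : constantCoeff N = 1 := by
    rw [hN]; simp
  induction j generalizing i with
  | zero =>
    rcases Nat.eq_zero_or_pos i with rfl | hi
    · simp
    · have : (i : ℚ) ≠ 0 := by positivity
      simp [h0, hi.ne', this]
  | succ j ih =>
    induction i with
    | zero => simp [coeff_one]
    | succ i ihi =>
      -- This lowers either i or j, at the price of i + 3 in the second case; hence the outer
      -- induction is on j with i general.
      have h1 : N ^ (i + 1) = N ^ i + X * N ^ (i + 3) := by
        have h2 : N ^ (i + 1) = N ^ i * (1 + X * N ^ 3) := by rw [← hN]; ring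
        rw [h2]; ring
      rw [h1, map_add, coeff_succ_X_mul, Int.cast_add, ihi, ih (i + 3)]
      have e1 : 3 * (j + 1) + (i + 1) = (3 * j + i + 3) + 1 := by ring
      have e2 : 3 * (j + 1) + i = 3 * j + i + 3 := by ring
      have e3 : 3 * j + (i + 3) = 3 * j + i + 3 := by ring
      rw [e1, e2, e3, Nat.choose_succ_succ (3 * j + i + 3) j, Nat.succ_eq_add_one]
      have h3 : ((3 * j + i + 3).choose (j + 1) : ℚ) * (j + 1)
          = (3 * j + i + 3).choose j * (2 * j + i + 3) := by
        have h4 := Nat.choose_succ_right_eq (3 * j + i + 3) j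
        rw [show 3 * j + i + 3 - j = 2 * j + i + 3 by omega] at h4
        exact_mod_cast h4
      have p1 : (3 * (j : ℚ) + i + 3) ≠ 0 := by positivity
      have p2 : (3 * (j : ℚ) + i + 4) ≠ 0 := by positivity
      simp only [Nat.add_eq_zero_iff, one_ne_zero, OfNat.ofNat_ne_zero, and_false, false_and,
        if_false]
      push_cast
      rw [show 3 * ((j : ℚ) + 1) + i = 3 * j + i + 3 by ring,
        show 3 * (j : ℚ) + (i + 3) = 3 * j + i + 3 by ring,
        show 3 * ((j : ℚ) + 1) + (i + 1) = 3 * j + i + 4 by ring]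
      field_simp
      linear_combination (-3) * h3

theorem catalanGenFun_eq : catalanGenFun = 1 + X * catalanGenFun ^ 2 := by
  have h := congrArg (PowerSeries.map (Nat.castRingHom ℤ)) catalanSeries_sq_mul_X_add_one
  simp only [map_add, map_mul, map_pow, map_one, map_X] at h
  rw [catalanGenFun]
  linear_combination -h

theorem hasSubst_two_mul_X_mul (N : ℤ⟦X⟧) : HasSubst (2 * X * N : ℤ⟦X⟧) :=
  HasSubst.of_constantCoeff_zero' (by simp)

/-- Both sides solve the same quadratic equation, and their difference is annihilated by a series
with constant term 1, a unit. -/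
theorem eq_subst_catalanGenFun {D N : ℤ⟦X⟧} (hD : D = 1 + 2 * X * N * D ^ 2) :
    D = subst (2 * X * N : ℤ⟦X⟧) catalanGenFun := by
  have hs := hasSubst_two_mul_X_mul N
  set E := subst (2 * X * N : ℤ⟦X⟧) catalanGenFun with hE
  have h1 : E = 1 + 2 * X * N * E ^ 2 := by
    have h2 := congrArg (substAlgHom (R := ℤ) hs) catalanGenFun_eq
    simp only [map_add, map_mul, map_pow, map_one, coe_substAlgHom, subst_X hs] at h2
    exact h2
  have hu : IsUnit (1 - 2 * X * N * (D + E)) := by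
    rw [isUnit_iff_constantCoeff]; simp
  have h3 : (1 - 2 * X * N * (D + E)) * (D - E) = 0 := by
    linear_combination hD - h1
  exact sub_eq_zero.1 ((hu.mul_right_eq_zero).1 h3)

theorem coeff_subst_catalanGenFun {N : ℤ⟦X⟧} (hN : N = 1 + X * N ^ 3) (n : ℕ) :
    ((coeff n (subst (2 * X * N : ℤ⟦X⟧) catalanGenFun) : ℤ) : ℚ) =
      ∑ p ∈ Finset.HasAntidiagonal.antidiagonal n,
        (if p.1 = 0 ∧ p.2 = 0 then (1 : ℚ) else (p.1 : ℚ) / (3 * (p.2 : ℚ) + (p.1 : ℚ)))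
          * (Nat.choose (3 * p.2 + p.1) p.2 : ℚ) * 2 ^ p.1 * (catalan p.1 : ℚ) := by
  have hs := hasSubst_two_mul_X_mul N
  have hpow : ∀ i, (2 * X * N : ℤ⟦X⟧) ^ i = X ^ i * (C (2 ^ i : ℤ) * N ^ i) := by
    intro i
    rw [mul_pow, mul_pow, map_pow, show (C (2 : ℤ) : ℤ⟦X⟧) = 2 from map_ofNat _ 2]; ring
  rw [coeff_subst' hs, finsum_eq_sum_of_support_subset (s := Finset.range (n + 1))]
  · rw [Finset.Nat.sum_antidiagonal_eq_sum_range_succ_mk, Int.cast_sum]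
    refine Finset.sum_congr rfl fun i hi => ?_
    have hi' : i ≤ n := by simpa [Nat.lt_succ_iff] using hi
    rw [hpow, coeff_X_pow_mul', if_pos hi', coeff_C_mul, smul_eq_mul]
    push_cast
    rw [coeff_pow_of_eq_one_add_X_mul_cube hN]
    have : ((coeff i catalanGenFun : ℤ) : ℚ) = catalan i := by
      simp [catalanGenFun, coeff_map, catalanSeries]
    rw [this]; ring
  · intro i hi
    by_contra h
    have hi' : ¬ i ≤ n := by simpa [Nat.lt_succ_iff] using h
    apply hi
    dsimp only
    rw [hpow, coeff_X_pow_mul', if_neg hi', smul_zero]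

end PowerSeriesLemmas

/-! ### Reachability along chords. -/

section Relations

/-- Source of the planarity arguments: a walk that leaves a region does so along some chord, which
non-crossing then restricts. -/
theorem Relation.ReflTransGen.exists_step_out {α : Type*} {R : α → α → Prop} {u v : α}
    (h : Relation.ReflTransGen R u v) (P : α → Prop) (hu : P u) (hv : ¬ P v) :
    ∃ x y, Relation.ReflTransGen R u x ∧ R x y ∧ P x ∧ ¬ P y := by
  induction h with
  | refl => exact absurd hu hv
  | @tail y z hy hyz ih =>
    by_cases hPy : P y
    · exact ⟨y, z, hy, hyz, hPy, hv⟩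
    · exact ih hPy

/-- Two points are joined by a chord of `E`, chords being recorded as increasing pairs. -/
def ChordAdj (E : Finset (ℕ × ℕ)) (x y : ℕ) : Prop := (x, y) ∈ E ∨ (y, x) ∈ E

theorem ChordAdj.symm {E : Finset (ℕ × ℕ)} {x y : ℕ} (h : ChordAdj E x y) : ChordAdj E y x :=
  Or.symm h

theorem ChordAdj.mono {E F : Finset (ℕ × ℕ)} (hEF : E ⊆ F) {x y : ℕ} (h : ChordAdj E x y) :
    ChordAdj F x y :=
  h.imp (fun h => hEF h) (fun h => hEF h)

/-- Reachability through the chords of `E`. -/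
abbrev ChordReach (E : Finset (ℕ × ℕ)) : ℕ → ℕ → Prop := Relation.ReflTransGen (ChordAdj E)

theorem ChordReach.symm {E : Finset (ℕ × ℕ)} {x y : ℕ} (h : ChordReach E x y) :
    ChordReach E y x :=
  by
  induction h with
  | refl => exact .refl
  | tail _ h ih => exact ih.head h.symm

theorem ChordReach.mono {E F : Finset (ℕ × ℕ)} (hEF : E ⊆ F) {x y : ℕ} (h : ChordReach E x y) :
    ChordReach F x y :=
  Relation.ReflTransGen.mono (fun _ _ h => h.mono hEF) _ _ h

/-- Reachability through chords of `E` along which the label `L` weakly increases. -/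
abbrev RisingReach (E : Finset (ℕ × ℕ)) (L : ℕ → ℕ) : ℕ → ℕ → Prop :=
  Relation.ReflTransGen fun x y => ChordAdj E x y ∧ L x ≤ L y

theorem RisingReach.le {E : Finset (ℕ × ℕ)} {L : ℕ → ℕ} {x y : ℕ} (h : RisingReach E L x y) :
    L x ≤ L y := by
  induction h with
  | refl => exact le_rfl
  | tail _ h ih => exact ih.trans h.2

theorem RisingReach.mono {E F : Finset (ℕ × ℕ)} (hEF : E ⊆ F) {L : ℕ → ℕ} {x y : ℕ}
    (h : RisingReach E L x y) : RisingReach F L x y :=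
  Relation.ReflTransGen.mono (fun _ _ h => ⟨h.1.mono hEF, h.2⟩) _ _ h

end Relations

/-- A set of chords on the points `a, …, b` that forms a non-crossing tree. -/
structure IsChordTree (a b : ℕ) (E : Finset (ℕ × ℕ)) : Prop where
  bounds : ∀ {x y}, (x, y) ∈ E → a ≤ x ∧ x < y ∧ y ≤ b
  noncrossing : ∀ {p q r s}, p < q → q < r → r < s → (p, r) ∈ E → (q, s) ∉ E
  connected : ∀ {u v}, a ≤ u → u ≤ b → a ≤ v → v ≤ b → ChordReach E u v
  bridge : ∀ {x y}, (x, y) ∈ E → ¬ ChordReach (E.erase (x, y)) x y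

/-- Planar ternary trees. -/
inductive TernaryTree where
  | leaf
  | node (l m r : TernaryTree)

/-! ### Ternary trees as non-crossing trees, and their descent-free labellings. -/

namespace TernaryTree

/-- The number of internal nodes. -/
def size : TernaryTree → ℕ
  | leaf => 0
  | node l m r => l.size + m.size + r.size + 1

/-- The non-crossing tree on `a, …, a + t.size` encoded by `t`: the longest chord at `a` ends in a
point `c`, the subtree `l` is what hangs at `a` after removing this chord, and `m` and `r` are the
parts to the left and to the right of `c` of the rest. -/
def edges : TernaryTree → ℕ → Finset (ℕ × ℕ)
  | leaf, _ => ∅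
  | node l m r, a => insert (a, a + l.size + 1 + m.size)
      (l.edges a ∪ m.edges (a + l.size + 1) ∪ r.edges (a + l.size + 1 + m.size))

/-- The `i` such that a descent-free labelling of `t.edges a` may rise between `i` and `i + 1`. -/
def freeGaps : TernaryTree → ℕ → Finset ℕ
  | leaf, _ => ∅
  | node l m r, a => insert (a + l.size)
      (l.freeGaps a ∪ r.freeGaps (a + l.size + 1 + m.size))

theorem mem_edges_node {l m r : TernaryTree} {a : ℕ} {e : ℕ × ℕ} :
    e ∈ (node l m r).edges a ↔ e = (a, a + l.size + 1 + m.size) ∨ e ∈ l.edges a ∨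
      e ∈ m.edges (a + l.size + 1) ∨ e ∈ r.edges (a + l.size + 1 + m.size) := by
  simp [edges]

theorem edges_left_subset (l m r : TernaryTree) (a : ℕ) :
    l.edges a ⊆ (node l m r).edges a := fun _ h => mem_edges_node.2 (by tauto)

theorem edges_middle_subset (l m r : TernaryTree) (a : ℕ) :
    m.edges (a + l.size + 1) ⊆ (node l m r).edges a := fun _ h => mem_edges_node.2 (by tauto)

theorem edges_right_subset (l m r : TernaryTree) (a : ℕ) :
    r.edges (a + l.size + 1 + m.size) ⊆ (node l m r).edges a :=
  fun _ h => mem_edges_node.2 (by tauto)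

theorem edges_bounds {t : TernaryTree} {a x y : ℕ} (h : (x, y) ∈ t.edges a) :
    a ≤ x ∧ x < y ∧ y ≤ a + t.size := by
  induction t generalizing a with
  | leaf => simp [edges] at h
  | node l m r ihl ihm ihr =>
    simp only [size]
    rcases mem_edges_node.1 h with h | h | h | h
    · rw [Prod.mk.injEq] at h; omega
    · have := ihl h; omega
    · have := ihm h; omega
    · have := ihr h; omega

theorem edges_noncrossing {t : TernaryTree} {a p q r s : ℕ} (hpq : p < q) (hqr : q < r)
    (hrs : r < s) (h1 : (p, r) ∈ t.edges a) : (q, s) ∉ t.edges a := by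
  intro h2
  induction t generalizing a with
  | leaf => simp [edges] at h1
  | node t1 t2 t3 ih1 ih2 ih3 =>
    rcases mem_edges_node.1 h1 with h1 | h1 | h1 | h1 <;>
    rcases mem_edges_node.1 h2 with h2 | h2 | h2 | h2
    all_goals
      first
      | exact ih1 h1 h2
      | exact ih2 h1 h2
      | exact ih3 h1 h2
      | (simp only [Prod.mk.injEq] at h1 h2; omega)
      | (simp only [Prod.mk.injEq] at h1; have := edges_bounds h2; omega)
      | (simp only [Prod.mk.injEq] at h2; have := edges_bounds h1; omega)
      | (have := edges_bounds h1; have := edges_bounds h2; omega)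

/-- The upper bound suffices: a connected graph on `t.size + 1` points with at most `t.size` edges
is a tree. -/
theorem card_edges_le (t : TernaryTree) (a : ℕ) : (t.edges a).card ≤ t.size := by
  induction t generalizing a with
  | leaf => simp [edges]
  | node l m r ihl ihm ihr =>
    have h1 := Finset.card_insert_le (a, a + l.size + 1 + m.size)
      (l.edges a ∪ m.edges (a + l.size + 1) ∪ r.edges (a + l.size + 1 + m.size))
    have h2 := Finset.card_union_le (l.edges a ∪ m.edges (a + l.size + 1))
      (r.edges (a + l.size + 1 + m.size))
    have h3 := Finset.card_union_le (l.edges a) (m.edges (a + l.size + 1))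
    have := ihl a
    have := ihm (a + l.size + 1)
    have := ihr (a + l.size + 1 + m.size)
    simp only [edges, size]
    omega

theorem edges_chordReach {t : TernaryTree} {a v : ℕ} (h1 : a ≤ v) (h2 : v ≤ a + t.size) :
    ChordReach (t.edges a) a v := by
  induction t generalizing a v with
  | leaf =>
    simp only [size] at h2
    obtain rfl : a = v := by omega
    exact Relation.ReflTransGen.refl
  | node l m r ihl ihm ihr =>
    simp only [size] at h2
    have hc : ChordReach ((node l m r).edges a) a (a + l.size + 1 + m.size) :=
      Relation.ReflTransGen.single (Or.inl (mem_edges_node.2 (Or.inl rfl)))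
    by_cases hl : v ≤ a + l.size
    · exact (ihl h1 hl).mono (edges_left_subset ..)
    by_cases hm : v ≤ a + l.size + 1 + m.size
    · have e1 := (ihm (a := a + l.size + 1) (by omega) le_rfl).symm.mono
        (edges_middle_subset l m r a)
      exact (hc.trans e1).trans ((ihm (by omega) hm).mono (edges_middle_subset l m r a))
    · exact hc.trans ((ihr (by omega) (by omega)).mono (edges_right_subset ..))

theorem edges_right_of_gap {l m r : TernaryTree} {a x y : ℕ} (h : (x, y) ∈ (node l m r).edges a)
    (hx : x ≤ a + l.size) (hy : a + l.size < y) : (x, y) = (a, a + l.size + 1 + m.size) := by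
  rcases mem_edges_node.1 h with h | h | h | h
  · exact h
  all_goals have := edges_bounds h; omega

/-- This and the next two lemmas recover the subtrees from the chord set once the sizes of `l` and
`m` are known, as injectivity of the encoding requires. -/
theorem edges_left_eq_filter (l m r : TernaryTree) (a : ℕ) :
    l.edges a = ((node l m r).edges a).filter fun e => e.2 ≤ a + l.size := by
  ext ⟨x, y⟩
  rw [Finset.mem_filter]
  refine ⟨fun h => ⟨edges_left_subset _ _ _ _ h, (edges_bounds h).2.2⟩, fun ⟨h, hy⟩ => ?_⟩
  dsimp only at hy
  rcases mem_edges_node.1 h with h | h | h | h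
  · rw [Prod.mk.injEq] at h; omega
  · exact h
  all_goals have := edges_bounds h; omega

theorem edges_middle_eq_filter (l m r : TernaryTree) (a : ℕ) :
    m.edges (a + l.size + 1) = ((node l m r).edges a).filter fun e =>
      a + l.size + 1 ≤ e.1 ∧ e.2 ≤ a + l.size + 1 + m.size := by
  ext ⟨x, y⟩
  rw [Finset.mem_filter]
  refine ⟨fun h => ⟨edges_middle_subset _ _ _ _ h, (edges_bounds h).1, (edges_bounds h).2.2⟩,
    fun ⟨h, hy⟩ => ?_⟩
  dsimp only at hy
  rcases mem_edges_node.1 h with h | h | h | h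
  · rw [Prod.mk.injEq] at h; omega
  · have := edges_bounds h; omega
  · exact h
  · have := edges_bounds h; omega

theorem edges_right_eq_filter (l m r : TernaryTree) (a : ℕ) :
    r.edges (a + l.size + 1 + m.size) = ((node l m r).edges a).filter fun e =>
      a + l.size + 1 + m.size ≤ e.1 := by
  ext ⟨x, y⟩
  rw [Finset.mem_filter]
  refine ⟨fun h => ⟨edges_right_subset _ _ _ _ h, (edges_bounds h).1⟩, fun ⟨h, hy⟩ => ?_⟩
  dsimp only at hy
  rcases mem_edges_node.1 h with h | h | h | h
  · rw [Prod.mk.injEq] at h; omega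
  · have := edges_bounds h; omega
  · have := edges_bounds h; omega
  · exact h

theorem chord_le_of_edges {l m r : TernaryTree} {a y : ℕ} (h : (a, y) ∈ (node l m r).edges a) :
    y ≤ a + l.size + 1 + m.size := by
  rcases mem_edges_node.1 h with h | h | h | h
  · rw [Prod.mk.injEq] at h; omega
  all_goals have := edges_bounds h; omega

/-- If `l'` were larger, its chords would connect a across the gap after `l`. The only chord over
that gap is the long one at a, which ends beyond the block of `l'`. -/
theorem left_size_le_of_edges_eq {l m r l' m' r' : TernaryTree} {a : ℕ}
    (h : (node l m r).edges a = (node l' m' r').edges a)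
    (hc : a + l.size + 1 + m.size = a + l'.size + 1 + m'.size) : l'.size ≤ l.size := by
  by_contra! hlt
  have hr := edges_chordReach (t := l') (a := a) (v := a + l.size + 1) (by omega) (by omega)
  obtain ⟨x, y, -, hxy, hx, hy⟩ := hr.exists_step_out (· ≤ a + l.size) (by omega) (by omega)
  have key : (x, y) ∈ l'.edges a := by
    rcases hxy with hxy | hxy
    · exact hxy
    · have := edges_bounds hxy; omega
  have h1 := edges_right_of_gap (h ▸ edges_left_subset l' m' r' a key) hx (by omega)
  have := edges_bounds key
  rw [Prod.mk.injEq] at h1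
  omega

theorem edges_injective {t t' : TernaryTree} {a : ℕ} (h : t.edges a = t'.edges a) : t = t' := by
  induction t generalizing t' a with
  | leaf =>
    cases t' with
    | leaf => rfl
    | node l' m' r' =>
      have := h ▸ (mem_edges_node (l := l') (m := m') (r := r') (a := a)).2 (Or.inl rfl)
      simp [edges] at this
  | node l m r ihl ihm ihr =>
    cases t' with
    | leaf =>
      have := h ▸ (mem_edges_node (l := l) (m := m) (r := r) (a := a)).2 (Or.inl rfl)
      simp [edges] at this
    | node l' m' r' =>
      have hc : a + l.size + 1 + m.size = a + l'.size + 1 + m'.size :=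
        le_antisymm (chord_le_of_edges (h ▸ mem_edges_node.2 (Or.inl rfl)))
          (chord_le_of_edges (h.symm ▸ mem_edges_node.2 (Or.inl rfl)))
      have hl : l.size = l'.size :=
        le_antisymm (left_size_le_of_edges_eq h.symm hc.symm) (left_size_le_of_edges_eq h hc)
      have hm : m.size = m'.size := by omega
      have h1 : l = l' := ihl (a := a) (by
        rw [edges_left_eq_filter l m r, edges_left_eq_filter l' m' r', h, hl])
      have h2 : m = m' := ihm (a := a + l.size + 1) (by
        rw [edges_middle_eq_filter l m r, hl, edges_middle_eq_filter l' m' r', h, hm])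
      have h3 : r = r' := ihr (a := a + l.size + 1 + m.size) (by
        rw [edges_right_eq_filter l m r, hl, hm, edges_right_eq_filter l' m' r', h])
      rw [h1, h2, h3]

theorem freeGaps_bounds {t : TernaryTree} {a i : ℕ} (h : i ∈ t.freeGaps a) :
    a ≤ i ∧ i < a + t.size := by
  induction t generalizing a with
  | leaf => simp [freeGaps] at h
  | node l m r ihl ihm ihr =>
    simp only [freeGaps, Finset.mem_insert, Finset.mem_union] at h
    simp only [size]
    rcases h with h | h | h
    · omega
    · have := ihl h; omega
    · have := ihr h; omega

/-- The number of free gaps. -/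
def rank : TernaryTree → ℕ
  | leaf => 0
  | node l _ r => l.rank + r.rank + 1

theorem card_freeGaps (t : TernaryTree) (a : ℕ) : (t.freeGaps a).card = t.rank := by
  induction t generalizing a with
  | leaf => rfl
  | node l m r ihl ihm ihr =>
    rw [freeGaps, Finset.card_insert_of_notMem, Finset.card_union_of_disjoint, ihl, ihr, rank]
    · rw [Finset.disjoint_left]
      intro i h1 h2
      have := freeGaps_bounds h1
      have := freeGaps_bounds h2
      omega
    · rw [Finset.mem_union]
      rintro (h | h)
      all_goals have := freeGaps_bounds h; omega

/-- Each block has a single entrance: a for `l`, and c = a + l.size + 1 + m.size for both `m` and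
`r`. Whenever the walk changes block it stands at the new entrance, so the part since then stays
inside one block. -/
theorem risingReach_node {l m r : TernaryTree} {a v : ℕ} {L : ℕ → ℕ}
    (h : RisingReach ((node l m r).edges a) L a v) :
    (v ≤ a + l.size → RisingReach (l.edges a) L a v) ∧
    (a + l.size < v → v ≤ a + l.size + 1 + m.size →
      RisingReach (m.edges (a + l.size + 1)) L (a + l.size + 1 + m.size) v) ∧
    (a + l.size + 1 + m.size ≤ v →
      RisingReach (r.edges (a + l.size + 1 + m.size)) L (a + l.size + 1 + m.size) v) := by
  induction h with
  | refl => exact ⟨fun _ => .refl, fun h => by omega, fun h => by omega⟩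
  | @tail x y _ hxy ih =>
    obtain ⟨ih1, ih2, ih3⟩ := ih
    obtain ⟨hj, hL⟩ := hxy
    have key : (x = a ∧ y = a + l.size + 1 + m.size) ∨ (y = a ∧ x = a + l.size + 1 + m.size) ∨
        ChordAdj (l.edges a) x y ∨ ChordAdj (m.edges (a + l.size + 1)) x y ∨
        ChordAdj (r.edges (a + l.size + 1 + m.size)) x y := by
      rcases hj with hj | hj <;>
        rcases mem_edges_node.1 hj with h | h | h | h
      · exact Or.inl (Prod.mk.inj h)
      · exact Or.inr (Or.inr (Or.inl (Or.inl h)))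
      · exact Or.inr (Or.inr (Or.inr (Or.inl (Or.inl h))))
      · exact Or.inr (Or.inr (Or.inr (Or.inr (Or.inl h))))
      · exact Or.inr (Or.inl (Prod.mk.inj h))
      · exact Or.inr (Or.inr (Or.inl (Or.inr h)))
      · exact Or.inr (Or.inr (Or.inr (Or.inl (Or.inr h))))
      · exact Or.inr (Or.inr (Or.inr (Or.inr (Or.inr h))))
    rcases key with ⟨rfl, rfl⟩ | ⟨rfl, rfl⟩ | h | h | h
    · exact ⟨fun h => by omega, fun _ _ => .refl, fun _ => .refl⟩
    · exact ⟨fun _ => .refl, fun h => by omega, fun h => by omega⟩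
    · have hb : x ≤ a + l.size ∧ y ≤ a + l.size := by
        rcases h with h | h <;> have := edges_bounds h <;> omega
      exact ⟨fun _ => (ih1 hb.1).tail ⟨h, hL⟩, fun h => by omega, fun h => by omega⟩
    · have hb : a + l.size < x ∧ x ≤ a + l.size + 1 + m.size ∧ a + l.size < y ∧
          y ≤ a + l.size + 1 + m.size := by
        rcases h with h | h <;> have := edges_bounds h <;> omega
      refine ⟨fun h => by omega, fun _ _ => (ih2 hb.1 hb.2.1).tail ⟨h, hL⟩, fun h => ?_⟩
      obtain rfl : y = a + l.size + 1 + m.size := by omega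
      exact .refl
    · have hb : a + l.size + 1 + m.size ≤ x ∧ a + l.size + 1 + m.size ≤ y := by
        rcases h with h | h <;> have := edges_bounds h <;> omega
      refine ⟨fun h => by omega, fun _ h => ?_, fun _ => (ih3 hb.1).tail ⟨h, hL⟩⟩
      obtain rfl : y = a + l.size + 1 + m.size := by omega
      exact .refl

theorem risingReach_of_const {E : Finset (ℕ × ℕ)} {L : ℕ → ℕ} {a b k : ℕ}
    (hE : ∀ {x y}, (x, y) ∈ E → a ≤ x ∧ x < y ∧ y ≤ b)
    (hL : ∀ i, a ≤ i → i ≤ b → L i = k) {u v : ℕ} (h : ChordReach E u v) :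
    RisingReach E L u v := by
  refine Relation.ReflTransGen.mono (fun x y hxy => ⟨hxy, ?_⟩) _ _ h
  have : a ≤ x ∧ x ≤ b ∧ a ≤ y ∧ y ≤ b := by
    rcases hxy with h | h <;> have := hE h <;> omega
  rw [hL x this.1 this.2.1, hL y this.2.2.1 this.2.2.2]

/-- The middle block is entered at its last point. Reaching its first point without descent, against
monotonicity of `L`, forces `L` to be constant there; the other blocks are entered at their first
points and recurse. -/
theorem forall_risingReach_iff {t : TernaryTree} {a : ℕ} {L : ℕ → ℕ} (hL : Monotone L) :
    (∀ v, a ≤ v → v ≤ a + t.size → RisingReach (t.edges a) L a v) ↔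
      ∀ i, a ≤ i → i < a + t.size → L i ≠ L (i + 1) → i ∈ t.freeGaps a := by
  induction t generalizing a with
  | leaf =>
    simp only [size]
    refine ⟨fun _ i h1 h2 => by omega, fun _ v h1 h2 => ?_⟩
    obtain rfl : a = v := by omega
    exact .refl
  | node l m r ihl ihm ihr =>
    simp only [size, freeGaps, Finset.mem_insert, Finset.mem_union]
    constructor
    · intro H i h1 h2 hne
      have hl := (ihl (a := a)).1 fun v h3 h4 =>
        (risingReach_node (H v h3 (by omega))).1 h4
      have hr := (ihr (a := a + l.size + 1 + m.size)).1 fun v h3 h4 =>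
        (risingReach_node (H v (by omega) (by omega))).2.2 h3
      have hm := ((risingReach_node (H (a + l.size + 1) (by omega) (by omega))).2.1
        (by omega) (by omega)).le
      rcases lt_trichotomy i (a + l.size) with h | h | h
      · exact Or.inr (Or.inl (hl i h1 h hne))
      · exact Or.inl h
      · by_cases h' : i < a + l.size + 1 + m.size
        · have e1 : L (a + l.size + 1) ≤ L i := hL (by omega)
          have e2 : L i ≤ L (i + 1) := hL (by omega)
          have e3 : L (i + 1) ≤ L (a + l.size + 1 + m.size) := hL (by omega)
          omega
        · exact Or.inr (Or.inr (hr i (by omega) (by omega) hne))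
    · intro H v h1 h2
      have hc : RisingReach ((node l m r).edges a) L a (a + l.size + 1 + m.size) :=
        Relation.ReflTransGen.single ⟨Or.inl (mem_edges_node.2 (Or.inl rfl)), hL (by omega)⟩
      by_cases hv : v ≤ a + l.size
      · refine ((ihl (a := a)).2 (fun i h3 h4 hne => ?_) v h1 hv).mono (edges_left_subset ..)
        rcases H i h3 (by omega) hne with h | h | h
        · omega
        · exact h
        · have := freeGaps_bounds h; omega
      by_cases hv' : v ≤ a + l.size + 1 + m.size
      · have hconst : ∀ d, d ≤ m.size → L (a + l.size + 1 + d) = L (a + l.size + 1) := by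
          intro d hd
          induction d with
          | zero => rfl
          | succ d ihd =>
            rw [← ihd (by omega)]
            by_contra hne
            rcases H (a + l.size + 1 + d) (by omega) (by omega) (Ne.symm hne) with h | h | h
            · omega
            all_goals have := freeGaps_bounds h; omega
        have hreach : ChordReach (m.edges (a + l.size + 1)) (a + l.size + 1 + m.size) v :=
          (edges_chordReach (by omega) le_rfl).symm.trans (edges_chordReach (by omega) hv')
        refine hc.trans ((risingReach_of_const (k := L (a + l.size + 1)) edges_bounds
          (fun i h3 h4 => ?_) hreach).mono (edges_middle_subset l m r a))
        · have := hconst (i - (a + l.size + 1)) (by omega)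
          rwa [show a + l.size + 1 + (i - (a + l.size + 1)) = i by omega] at this
      · refine hc.trans (((ihr (a := a + l.size + 1 + m.size)).2 (fun i h3 h4 hne => ?_) v
          (by omega) (by omega)).mono (edges_right_subset ..))
        rcases H i (by omega) (by omega) hne with h | h | h
        · omega
        · have := freeGaps_bounds h; omega
        · exact h

end TernaryTree

/-! ### Every non-crossing tree comes from a ternary tree. -/

section Decomposition

/-- A chord from strictly under (α, β) to strictly outside would cross it, so the walk leaves
through α or β, and β is adjacent to α. -/
theorem ChordReach.to_left_end_of_leaves {E : Finset (ℕ × ℕ)} (hlt : ∀ {x y}, (x, y) ∈ E → x < y)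
    (hnc : ∀ {p q r s}, p < q → q < r → r < s → (p, r) ∈ E → (q, s) ∉ E) {α β u v : ℕ}
    (hαβ : (α, β) ∈ E) (h : ChordReach E u v) (hu : α < u ∧ u < β) (hv : ¬ (α < v ∧ v < β)) :
    ChordReach E u α := by
  obtain ⟨x, y, hux, hxy, hx, hy⟩ := h.exists_step_out (fun z => α < z ∧ z < β) hu hv
  by_cases h1 : y = α
  · exact h1 ▸ hux.tail hxy
  by_cases h2 : y = β
  · subst h2
    exact (hux.tail hxy).tail (Or.inr hαβ)
  exfalso
  rcases hxy with hxy | hxy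
  · have := hlt hxy
    exact hnc hx.1 hx.2 (by omega) hαβ hxy
  · have := hlt hxy
    exact hnc (by omega) hx.1 hx.2 hxy hαβ

/-- Components do not cross: the chord by which the walk from q leaves the interval (p, r) either
ends at p or r, or separates p from r, and then the walk between p and r meets one of its ends. -/
theorem ChordReach.of_interleave {E : Finset (ℕ × ℕ)} (hlt : ∀ {x y}, (x, y) ∈ E → x < y)
    (hnc : ∀ {p q r s}, p < q → q < r → r < s → (p, r) ∈ E → (q, s) ∉ E) {p q r s : ℕ}
    (hpq : p < q) (hqr : q < r) (hrs : r < s) (hpr : ChordReach E p r) (hqs : ChordReach E q s) :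
    ChordReach E p q := by
  obtain ⟨x, y, hqx, hxy, hx, hy⟩ :=
    hqs.exists_step_out (fun z => p < z ∧ z < r) ⟨hpq, hqr⟩ (by omega)
  have hqy := hqx.tail hxy
  by_cases h1 : y = p
  · exact h1 ▸ (ChordReach.symm hqy)
  by_cases h2 : y = r
  · subst h2
    exact hpr.trans (ChordReach.symm hqy)
  rcases hxy with hxy | hxy
  · have := hlt hxy
    exact hpr.trans ((ChordReach.to_left_end_of_leaves hlt hnc hxy hpr.symm
      (by omega) (by omega)).trans (ChordReach.symm hqx))
  · have := hlt hxy
    exact (ChordReach.to_left_end_of_leaves hlt hnc hxy hpr (by omega) (by omega)).trans (ChordReach.symm hqy)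

/-- Non-crossing and acyclicity, the latter phrased through bridges, pass to subsets; only the range
and connectivity need checking. -/
theorem IsChordTree.of_subset {a b a' b' z : ℕ} {E F : Finset (ℕ × ℕ)} (hE : IsChordTree a b E)
    (hFE : F ⊆ E) (hb : ∀ {x y}, (x, y) ∈ F → a' ≤ x ∧ x < y ∧ y ≤ b')
    (hz : ∀ {v}, a' ≤ v → v ≤ b' → ChordReach F z v) : IsChordTree a' b' F where
  bounds := hb
  noncrossing h1 h2 h3 h4 h5 := hE.noncrossing h1 h2 h3 (hFE h4) (hFE h5)
  connected h1 h2 h3 h4 := (hz h1 h2).symm.trans (hz h3 h4)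
  bridge h1 h2 := hE.bridge (hFE h1) (h2.mono (Finset.erase_subset_erase _ hFE))

/-- The pieces of a non-crossing tree after removing the longest chord at its first point. -/
theorem IsChordTree.exists_decomposition {a b : ℕ} {E : Finset (ℕ × ℕ)} (hE : IsChordTree a b E)
    (hab : a < b) : ∃ (q c : ℕ) (E₁ E₂ E₃ : Finset (ℕ × ℕ)), a ≤ q ∧ q < c ∧ c ≤ b ∧
      IsChordTree a q E₁ ∧ IsChordTree (q + 1) c E₂ ∧ IsChordTree c b E₃ ∧
      E = insert (a, c) (E₁ ∪ E₂ ∪ E₃) := by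
  classical
  obtain ⟨c, hc, hmax⟩ : ∃ c, (a, c) ∈ E ∧ ∀ y, (a, y) ∈ E → y ≤ c := by
    obtain ⟨x, y, -, hxy, rfl, hy⟩ :=
      (hE.connected le_rfl hab.le hab.le le_rfl).exists_step_out (· = a) rfl (by omega)
    have hxy' : (x, y) ∈ E := by
      rcases hxy with h | h
      · exact h
      · have := hE.bounds h; omega
    obtain ⟨⟨x', c⟩, hc, hm⟩ := Finset.exists_max_image (E.filter fun e => e.1 = x) Prod.snd
      ⟨(x, y), Finset.mem_filter.2 ⟨hxy', rfl⟩⟩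
    obtain ⟨hc1, hc2⟩ := Finset.mem_filter.1 hc
    dsimp only at hc2
    subst hc2
    exact ⟨c, hc1, fun y hy => hm (x', y) (Finset.mem_filter.2 ⟨hy, rfl⟩)⟩
  have hcb := hE.bounds hc
  set E' := E.erase (a, c) with hE'
  have hsub : E' ⊆ E := Finset.erase_subset _ _
  have hlt : ∀ {x y}, (x, y) ∈ E' → x < y := fun h => (hE.bounds (hsub h)).2.1
  have hnc : ∀ {p q r s}, p < q → q < r → r < s → (p, r) ∈ E' → (q, s) ∉ E' :=
    fun h1 h2 h3 h4 h5 => hE.noncrossing h1 h2 h3 (hsub h4) (hsub h5)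
  have hnot : ¬ ChordReach E' a c := hE.bridge hc
  -- Deleting the bridge (a, c) leaves two components, those of a and of c.
  have hsplit : ∀ v, a ≤ v → v ≤ b → ChordReach E' a v ∨ ChordReach E' c v := by
    intro v h1 h2
    have h := hE.connected le_rfl hab.le h1 h2
    clear h1 h2
    induction h with
    | refl => exact Or.inl .refl
    | @tail x y _ hxy ih =>
      by_cases h1 : y = c
      · exact Or.inr (h1 ▸ .refl)
      by_cases h2 : y = a
      · exact Or.inl (h2 ▸ .refl)
      have hxy' : ChordAdj E' x y := by
        refine hxy.imp (fun h => Finset.mem_erase.2 ⟨?_, h⟩)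
          (fun h => Finset.mem_erase.2 ⟨?_, h⟩)
        all_goals rw [Ne, Prod.mk.injEq]; tauto
      exact ih.imp (·.tail hxy') (·.tail hxy')
  -- A chord leading from below c to beyond c contradicts the maximality of c if it starts at a, and
  -- crosses (a, c) otherwise.
  have hltc : ∀ v, ChordReach E' a v → v < c := by
    intro v hv
    by_contra hvc
    obtain ⟨x, y, hax, hxy, hx, hy⟩ := hv.exists_step_out (· < c) (by omega) hvc
    have hay := hax.tail hxy
    have hxy' : (x, y) ∈ E := by
      rcases hxy with h | h
      · exact hsub h
      · have := hlt h; omega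
    have hyc : y ≠ c := fun h => hnot (h ▸ hay)
    rcases (hE.bounds hxy').1.eq_or_lt with rfl | hax'
    · have := hmax y hxy'; omega
    · exact hE.noncrossing hax' hx (by omega) hc hxy'
  -- The component of a is an initial interval: a point u of the other component would give
  -- interleaved pairs a < u < v < c.
  have hinit : ∀ u v, ChordReach E' a v → a ≤ u → u ≤ v → ChordReach E' a u := by
    intro u v hv hau huv
    have := hltc v hv
    rcases hau.eq_or_lt with rfl | hau
    · exact .refl
    rcases huv.eq_or_lt with rfl | huv
    · exact hv
    rcases hsplit u hau.le (by omega) with h | h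
    · exact h
    · exact ChordReach.of_interleave hlt hnc hau huv (hltc v hv) hv h.symm
  obtain ⟨q, hq, hqmax⟩ : ∃ q, ChordReach E' a q ∧ ∀ v, ChordReach E' a v → v ≤ q := by
    obtain ⟨q, hq, hm⟩ := Finset.exists_max_image ((Finset.range c).filter (ChordReach E' a)) id
      ⟨a, Finset.mem_filter.2 ⟨Finset.mem_range.2 (by omega), .refl⟩⟩
    exact ⟨q, (Finset.mem_filter.1 hq).2,
      fun v hv => hm v (Finset.mem_filter.2 ⟨Finset.mem_range.2 (hltc v hv), hv⟩)⟩
  have haq : a ≤ q := hqmax a .refl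
  have hqc : q < c := hltc q hq
  set E₁ := E'.filter (fun e => e.2 ≤ q) with hE₁
  set E₂ := E'.filter (fun e => q + 1 ≤ e.1 ∧ e.2 ≤ c) with hE₂
  set E₃ := E'.filter (fun e => c ≤ e.1) with hE₃
  have hclass : ∀ x y, (x, y) ∈ E' → (x, y) ∈ E₁ ∨ (x, y) ∈ E₂ ∨ (x, y) ∈ E₃ := by
    intro x y h
    simp only [hE₁, hE₂, hE₃, Finset.mem_filter, h, true_and]
    have hb := hE.bounds (hsub h)
    by_cases hy : y ≤ q
    · exact Or.inl hy
    have hx : q + 1 ≤ x := by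
      by_contra hx
      exact hy (hqmax y ((hinit x q hq hb.1 (by omega)).tail (Or.inl h)))
    by_cases hyc : y ≤ c
    · exact Or.inr (Or.inl ⟨hx, hyc⟩)
    refine Or.inr (Or.inr ?_)
    by_contra hxc
    exact hE.noncrossing (by omega) (by omega) (by omega) hc (hsub h)
  have hr1 : ∀ v, ChordReach E' a v → ChordReach E₁ a v := by
    intro v hv
    induction hv with
    | refl => exact .refl
    | @tail x y hx hxy ih =>
      have hx' := hqmax x hx
      have hy' := hqmax y (hx.tail hxy)
      exact ih.tail (hxy.imp (fun h => Finset.mem_filter.2 ⟨h, hy'⟩)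
        (fun h => Finset.mem_filter.2 ⟨h, hx'⟩))
  -- The pieces `E₂` and `E₃` share only the point c, so a walk from c that changes sides restarts
  -- at c.
  have hr2 : ∀ v, ChordReach E' c v →
      (v ≤ c → ChordReach E₂ c v) ∧ (c ≤ v → ChordReach E₃ c v) := by
    intro v hv
    induction hv with
    | refl => exact ⟨fun _ => .refl, fun _ => .refl⟩
    | @tail x y hx hxy ih =>
      have hx' : a ≤ x → q < x := fun h => by
        by_contra hxq
        exact hnot ((hinit x q hq h (by omega)).trans (ChordReach.symm hx))
      have key : ChordAdj E₂ x y ∨ ChordAdj E₃ x y := by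
        rcases hxy with h | h
        · rcases hclass _ _ h with h' | h' | h'
          · have := (Finset.mem_filter.1 h').2
            have := hE.bounds (hsub h)
            have := hx' (by omega)
            dsimp only at *
            omega
          · exact Or.inl (Or.inl h')
          · exact Or.inr (Or.inl h')
        · rcases hclass _ _ h with h' | h' | h'
          · have := (Finset.mem_filter.1 h').2
            have := hE.bounds (hsub h)
            have := hx' (by omega)
            dsimp only at *
            omega
          · exact Or.inl (Or.inr h')
          · exact Or.inr (Or.inr h')
      rcases key with h | h
      · have hb : x ≤ c ∧ y ≤ c := by
          rcases h with h | h <;> have h1 := hlt (Finset.mem_filter.1 h).1 <;>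
            have h2 := (Finset.mem_filter.1 h).2 <;> dsimp only at h2 <;> omega
        refine ⟨fun _ => (ih.1 hb.1).tail h, fun hcy => ?_⟩
        obtain rfl : c = y := by omega
        exact .refl
      · have hb : c ≤ x ∧ c ≤ y := by
          rcases h with h | h <;> have h1 := hlt (Finset.mem_filter.1 h).1 <;>
            have h2 := (Finset.mem_filter.1 h).2 <;> dsimp only at h2 <;> omega
        refine ⟨fun hyc => ?_, fun _ => (ih.2 hb.1).tail h⟩
        obtain rfl : c = y := by omega
        exact .refl
  have hright : ∀ v, q + 1 ≤ v → v ≤ b → ChordReach E' c v := by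
    intro v h1 h2
    rcases hsplit v (by omega) h2 with h | h
    · have := hqmax v h; omega
    · exact h
  refine ⟨q, c, E₁, E₂, E₃, haq, hqc, hcb.2.2, ?_, ?_, ?_, ?_⟩
  · refine hE.of_subset (z := a) ((Finset.filter_subset _ _).trans hsub) (fun {x y} h => ?_)
      (fun {v} h1 h2 => hr1 v (hinit v q hq h1 h2))
    obtain ⟨h1, h2⟩ := Finset.mem_filter.1 h
    have := hE.bounds (hsub h1)
    exact ⟨this.1, this.2.1, h2⟩
  · refine hE.of_subset (z := c) ((Finset.filter_subset _ _).trans hsub) (fun {x y} h => ?_)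
      (fun {v} h1 h2 => (hr2 v (hright v h1 (by omega))).1 h2)
    obtain ⟨h1, h2⟩ := Finset.mem_filter.1 h
    exact ⟨h2.1, hlt h1, h2.2⟩
  · refine hE.of_subset (z := c) ((Finset.filter_subset _ _).trans hsub) (fun {x y} h => ?_)
      (fun {v} h1 h2 => (hr2 v (hright v (by omega) h2)).2 h1)
    obtain ⟨h1, h2⟩ := Finset.mem_filter.1 h
    exact ⟨h2, hlt h1, (hE.bounds (hsub h1)).2.2⟩
  · ext ⟨x, y⟩
    simp only [Finset.mem_insert, Finset.mem_union]
    constructor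
    · intro h
      by_cases hxy : (x, y) = (a, c)
      · exact Or.inl hxy
      · rcases hclass x y (Finset.mem_erase.2 ⟨hxy, h⟩) with h | h | h <;> tauto
    · rintro (h | (h | h) | h)
      · exact h ▸ hc
      all_goals exact hsub (Finset.mem_filter.1 h).1

theorem IsChordTree.exists_ternaryTree {a n : ℕ} {E : Finset (ℕ × ℕ)}
    (hE : IsChordTree a (a + n) E) : ∃ t : TernaryTree, t.size = n ∧ t.edges a = E := by
  induction n using Nat.strong_induction_on generalizing a E with
  | _ n ih =>
    rcases Nat.eq_zero_or_pos n with rfl | hn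
    · refine ⟨.leaf, rfl, ?_⟩
      symm
      rw [TernaryTree.edges, Finset.eq_empty_iff_forall_notMem]
      rintro ⟨x, y⟩ h
      have := hE.bounds h
      omega
    · obtain ⟨q, c, E₁, E₂, E₃, haq, hqc, hcb, h1, h2, h3, rfl⟩ :=
        hE.exists_decomposition (by omega)
      obtain ⟨i, rfl⟩ := Nat.exists_eq_add_of_le haq
      obtain ⟨j, rfl⟩ := Nat.exists_eq_add_of_le (Nat.succ_le_of_lt hqc)
      obtain ⟨k, hk⟩ := Nat.exists_eq_add_of_le hcb
      rw [Nat.succ_eq_add_one] at *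
      rw [hk] at h3
      obtain ⟨l, rfl, rfl⟩ := ih i (by omega) h1
      obtain ⟨m, rfl, rfl⟩ := ih j (by omega) h2
      obtain ⟨r, rfl, rfl⟩ := ih k (by omega) h3
      exact ⟨.node l m r, by rw [TernaryTree.size]; omega, rfl⟩

end Decomposition

/-! ### Enumeration of ternary trees. -/

namespace TernaryTree

theorem finite_size_eq (n : ℕ) : {t : TernaryTree | t.size = n}.Finite := by
  refine Set.Finite.of_finite_image (f := fun t => t.edges 0) ?_
    (fun t _ t' _ h => edges_injective h)
  refine (Finset.finite_toSet (Finset.range (n + 1) ×ˢ Finset.range (n + 1)).powerset).subset ?_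
  rintro _ ⟨t, ht, rfl⟩
  simp only [Set.mem_ofPred_eq] at ht
  simp only [Finset.coe_powerset, Set.mem_preimage, Set.mem_powerset_iff, Finset.coe_subset]
  rintro ⟨x, y⟩ h
  have := edges_bounds h
  simp only [Finset.mem_product, Finset.mem_range]
  omega

/-- The ternary trees with `n` internal nodes. -/
noncomputable def ofSize (n : ℕ) : Finset TernaryTree := (finite_size_eq n).toFinset

@[simp]
theorem mem_ofSize {n : ℕ} {t : TernaryTree} : t ∈ ofSize n ↔ t.size = n := by
  simp [ofSize]

theorem ofSize_zero : ofSize 0 = {leaf} := by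
  ext t
  cases t <;> simp [size]

/-- The node constructor as an embedding of triples. -/
def nodeEmbedding : TernaryTree × TernaryTree × TernaryTree ↪ TernaryTree where
  toFun p := node p.1 p.2.1 p.2.2
  inj' := by
    rintro ⟨l, m, r⟩ ⟨l', m', r'⟩ h
    simpa using h

theorem sum_ofSize_succ {M : Type*} [AddCommMonoid M] (n : ℕ) (f : TernaryTree → M) :
    ∑ t ∈ ofSize (n + 1), f t = ∑ p ∈ Finset.HasAntidiagonal.antidiagonal n,
      ∑ q ∈ Finset.HasAntidiagonal.antidiagonal p.2, ∑ l ∈ ofSize p.1, ∑ m ∈ ofSize q.1,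
        ∑ r ∈ ofSize q.2, f (node l m r) := by
  classical
  have h : ofSize (n + 1) = (Finset.HasAntidiagonal.antidiagonal n).biUnion fun p =>
      (Finset.HasAntidiagonal.antidiagonal p.2).biUnion fun q =>
        (ofSize p.1 ×ˢ ofSize q.1 ×ˢ ofSize q.2).map nodeEmbedding := by
    ext t
    simp only [mem_ofSize, Finset.mem_biUnion, Finset.mem_map, Finset.mem_product,
      Finset.HasAntidiagonal.mem_antidiagonal]
    constructor
    · intro h
      cases t with
      | leaf => simp [size] at h
      | node l m r =>
        simp only [size] at h
        exact ⟨(l.size, m.size + r.size), by omega, (m.size, r.size), rfl, (l, m, r),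
          ⟨rfl, rfl, rfl⟩, rfl⟩
    · rintro ⟨p, hp, q, hq, ⟨l, m, r⟩, ⟨hl, hm, hr⟩, rfl⟩
      dsimp only at hl hm hr
      change (node l m r).size = n + 1
      rw [size]
      omega
  have hmem : ∀ (i j k : ℕ) (t : TernaryTree),
      t ∈ (ofSize i ×ˢ ofSize j ×ˢ ofSize k).map nodeEmbedding →
      ∃ l m r, t = node l m r ∧ l.size = i ∧ m.size = j ∧ r.size = k := by
    intro i j k t ht
    obtain ⟨⟨l, m, r⟩, h, rfl⟩ := Finset.mem_map.1 ht
    simp only [Finset.mem_product, mem_ofSize] at h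
    exact ⟨l, m, r, rfl, h⟩
  rw [h, Finset.sum_biUnion]
  · refine Finset.sum_congr rfl fun p _ => ?_
    rw [Finset.sum_biUnion]
    · refine Finset.sum_congr rfl fun q _ => ?_
      rw [Finset.sum_map, Finset.sum_product]
      refine Finset.sum_congr rfl fun l _ => ?_
      rw [Finset.sum_product]
      rfl
    · intro q _ q' _ hne
      rw [Function.onFun, Finset.disjoint_left]
      intro t h1 h2
      obtain ⟨l, m, r, rfl, -, h3, h4⟩ := hmem _ _ _ _ h1
      obtain ⟨l', m', r', e, -, h5, h6⟩ := hmem _ _ _ _ h2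
      obtain ⟨rfl, rfl, rfl⟩ := node.inj e
      exact hne (Prod.ext (h3.symm.trans h5) (h4.symm.trans h6))
  · intro p _ p' _ hne
    rw [Function.onFun, Finset.disjoint_left]
    intro t h1 h2
    obtain ⟨q, hq, h1⟩ := Finset.mem_biUnion.1 h1
    obtain ⟨q', hq', h2⟩ := Finset.mem_biUnion.1 h2
    obtain ⟨l, m, r, rfl, h0, h3, h4⟩ := hmem _ _ _ _ h1
    obtain ⟨l', m', r', e, h0', h5, h6⟩ := hmem _ _ _ _ h2
    obtain ⟨rfl, rfl, rfl⟩ := node.inj e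
    rw [Finset.HasAntidiagonal.mem_antidiagonal] at hq hq'
    exact hne (Prod.ext (by omega) (by omega))

/-- The generating function of ternary trees by number of nodes, weighted by `x ^ t.rank`. -/
noncomputable def rankGenFun (x : ℤ) : PowerSeries ℤ :=
  PowerSeries.mk fun n => ∑ t ∈ ofSize n, x ^ t.rank

-- The middle subtree contributes the factor `rankGenFun 1` because its gaps are never free; the
-- root contributes one free gap, hence the factor x.
open PowerSeries in
theorem rankGenFun_eq (x : ℤ) :
    rankGenFun x = 1 + C x * X * (rankGenFun x * (rankGenFun 1 * rankGenFun x)) := by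
  ext n
  rw [mul_assoc, map_add, coeff_C_mul]
  cases n with
  | zero => simp [rankGenFun, ofSize_zero, rank]
  | succ n =>
    rw [coeff_succ_X_mul, coeff_one, if_neg (Nat.succ_ne_zero n), zero_add, coeff_mul]
    simp only [coeff_mul, rankGenFun, coeff_mk, sum_ofSize_succ, one_pow, rank]
    rw [Finset.mul_sum]
    refine Finset.sum_congr rfl fun p _ => ?_
    rw [Finset.mul_sum, Finset.mul_sum]
    refine Finset.sum_congr rfl fun q _ => ?_
    rw [Finset.sum_mul, Finset.mul_sum]
    refine Finset.sum_congr rfl fun l _ => ?_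
    rw [Finset.sum_mul, Finset.mul_sum, Finset.mul_sum]
    refine Finset.sum_congr rfl fun m _ => ?_
    rw [one_mul, Finset.mul_sum, Finset.mul_sum]
    refine Finset.sum_congr rfl fun r _ => ?_
    ring

end TernaryTree

/-! ### Translation between graphs on `Fin (n + 1)` and chord sets on ℕ. -/

section ChordGraphs

variable {n : ℕ}

open Classical in
/-- The edges of a graph on `0, …, n`, as increasing pairs of natural numbers. -/
noncomputable def SimpleGraph.chords (G : SimpleGraph (Fin (n + 1))) : Finset (ℕ × ℕ) :=
  ((Finset.univ : Finset (Fin (n + 1) × Fin (n + 1))).filter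
    fun e => e.1 < e.2 ∧ G.Adj e.1 e.2).image fun e => ((e.1 : ℕ), (e.2 : ℕ))

theorem SimpleGraph.mem_chords {G : SimpleGraph (Fin (n + 1))} {x y : ℕ} :
    (x, y) ∈ G.chords ↔ x < y ∧ ∃ (hx : x < n + 1) (hy : y < n + 1), G.Adj ⟨x, hx⟩ ⟨y, hy⟩ := by
  classical
  simp only [SimpleGraph.chords, Finset.mem_image, Finset.mem_filter, Finset.mem_univ, true_and,
    Prod.mk.injEq]
  constructor
  · rintro ⟨⟨u, v⟩, ⟨h1, h2⟩, rfl, rfl⟩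
    exact ⟨h1, u.2, v.2, h2⟩
  · rintro ⟨h, hx, hy, hadj⟩
    exact ⟨(⟨x, hx⟩, ⟨y, hy⟩), ⟨h, hadj⟩, rfl, rfl⟩

theorem SimpleGraph.chordAdj_chords {G : SimpleGraph (Fin (n + 1))} {x y : ℕ} :
    ChordAdj G.chords x y ↔ ∃ (hx : x < n + 1) (hy : y < n + 1), G.Adj ⟨x, hx⟩ ⟨y, hy⟩ := by
  rw [ChordAdj, SimpleGraph.mem_chords, SimpleGraph.mem_chords]
  constructor
  · rintro (⟨-, hx, hy, h⟩ | ⟨-, hx, hy, h⟩)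
    · exact ⟨hx, hy, h⟩
    · exact ⟨hy, hx, h.symm⟩
  · rintro ⟨hx, hy, h⟩
    rcases lt_trichotomy x y with hxy | rfl | hxy
    · exact Or.inl ⟨hxy, hx, hy, h⟩
    · exact absurd h (SimpleGraph.irrefl _)
    · exact Or.inr ⟨hxy, hy, hx, h.symm⟩

theorem SimpleGraph.chords_injective :
    Function.Injective (SimpleGraph.chords : SimpleGraph (Fin (n + 1)) → Finset (ℕ × ℕ)) := by
  intro G H h
  ext u v
  have h1 := SimpleGraph.chordAdj_chords (G := G) (x := u) (y := v)
  have h2 := SimpleGraph.chordAdj_chords (G := H) (x := u) (y := v)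
  rw [h] at h1
  have h3 := h1.symm.trans h2
  exact ⟨fun h => (h3.1 ⟨u.2, v.2, h⟩).2.2, fun h => (h3.2 ⟨u.2, v.2, h⟩).2.2⟩

/-- The graph on `0, …, n` with the chords `E`. -/
def chordGraph (n : ℕ) (E : Finset (ℕ × ℕ)) : SimpleGraph (Fin (n + 1)) where
  Adj u v := u ≠ v ∧ ChordAdj E u v
  symm := ⟨fun _ _ h => ⟨h.1.symm, h.2.symm⟩⟩
  loopless := ⟨fun _ h => h.1 rfl⟩

theorem chords_chordGraph {E : Finset (ℕ × ℕ)} (hE : ∀ {x y}, (x, y) ∈ E → x < y ∧ y ≤ n) :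
    (chordGraph n E).chords = E := by
  ext ⟨x, y⟩
  rw [SimpleGraph.mem_chords]
  constructor
  · rintro ⟨h, hx, hy, -, h1 | h1⟩
    · exact h1
    · have := (hE h1).1
      dsimp only at this
      omega
  · intro h
    have := hE h
    exact ⟨this.1, by omega, by omega, by rw [Ne, Fin.mk.injEq]; omega, Or.inl h⟩

theorem Relation.ReflTransGen.fin_of_nat {R : Fin n → Fin n → Prop} {R' : ℕ → ℕ → Prop}
    (h : ∀ x y, R' x y → ∃ (hx : x < n) (hy : y < n), R ⟨x, hx⟩ ⟨y, hy⟩) {u v : ℕ}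
    (huv : Relation.ReflTransGen R' u v) (hu : u < n) (hv : v < n) :
    Relation.ReflTransGen R ⟨u, hu⟩ ⟨v, hv⟩ := by
  induction huv with
  | refl => exact .refl
  | tail _ hxy ih =>
    obtain ⟨hx, _, hR⟩ := h _ _ hxy
    exact (ih hx).tail hR

theorem SimpleGraph.isChordTree_chords {G : SimpleGraph (Fin (n + 1))} (hG : G.IsTree)
    (hnc : ∀ a b c d : Fin (n + 1), a < b → b < c → c < d → G.Adj a c → ¬ G.Adj b d) :
    IsChordTree 0 (0 + n) G.chords where
  bounds h := by
    obtain ⟨h1, _, h3, _⟩ := SimpleGraph.mem_chords.1 h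
    omega
  noncrossing h1 h2 h3 h4 h5 := by
    obtain ⟨_, hp, hr, h6⟩ := SimpleGraph.mem_chords.1 h4
    obtain ⟨_, hq, hs, h7⟩ := SimpleGraph.mem_chords.1 h5
    exact hnc _ _ _ _ (Fin.mk_lt_mk.2 h1) (Fin.mk_lt_mk.2 h2) (Fin.mk_lt_mk.2 h3) h6 h7
  connected {u v} _ hu _ hv := by
    have h := (SimpleGraph.reachable_iff_reflTransGen _ _).1
      (hG.connected.preconnected ⟨u, by omega⟩ ⟨v, by omega⟩)
    exact Relation.ReflTransGen.lift (fun x : Fin (n + 1) => (x : ℕ))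
      (fun x y hxy => SimpleGraph.chordAdj_chords.2 ⟨x.2, y.2, hxy⟩) _ _ h
  bridge {x y} h hr := by
    obtain ⟨hlt, hx, hy, hadj⟩ := SimpleGraph.mem_chords.1 h
    refine SimpleGraph.isBridge_iff.1
      (SimpleGraph.isAcyclic_iff_forall_adj_isBridge.1 hG.isAcyclic hadj) ?_
    rw [SimpleGraph.reachable_iff_reflTransGen]
    refine Relation.ReflTransGen.fin_of_nat (fun u v huv => ?_) hr hx hy
    obtain ⟨hu, hv, hadj'⟩ := SimpleGraph.chordAdj_chords.1
      (huv.mono (Finset.erase_subset _ _))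
    refine ⟨hu, hv, SimpleGraph.deleteEdges_adj.2 ⟨hadj', ?_⟩⟩
    rw [Set.mem_singleton_iff, Sym2.eq_iff, Fin.mk.injEq, Fin.mk.injEq, Fin.mk.injEq,
      Fin.mk.injEq]
    rintro (⟨rfl, rfl⟩ | ⟨rfl, rfl⟩)
    · rcases huv with h | h
      · simp at h
      · have := (SimpleGraph.mem_chords.1 (Finset.mem_of_mem_erase h)).1
        omega
    · rcases huv with h | h
      · have := (SimpleGraph.mem_chords.1 (Finset.mem_of_mem_erase h)).1
        omega
      · simp at h

theorem TernaryTree.isTree_chordGraph (t : TernaryTree) :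
    (chordGraph t.size (t.edges 0)).IsTree := by
  set G := chordGraph t.size (t.edges 0) with hG
  have hreach : ∀ v, G.Reachable 0 v := by
    intro v
    rw [SimpleGraph.reachable_iff_reflTransGen]
    refine Relation.ReflTransGen.fin_of_nat (fun x y hxy => ?_)
      (t.edges_chordReach (Nat.zero_le v) (by omega)) (Nat.succ_pos _) v.2
    have hb : x ≠ y ∧ x < t.size + 1 ∧ y < t.size + 1 := by
      rcases hxy with h | h <;> have := edges_bounds h <;> omega
    exact ⟨hb.2.1, hb.2.2, by rw [Ne, Fin.mk.injEq]; exact hb.1, hxy⟩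
  have hconn : G.Connected :=
    { preconnected := fun u v => (hreach u).symm.trans (hreach v) }
  refine SimpleGraph.isTree_iff_connected_and_card.2
    ⟨hconn, le_antisymm ?_ hconn.card_vert_le_card_edgeSet_add_one⟩
  have hsub : G.edgeSet ⊆ (fun e : ℕ × ℕ => s(Fin.ofNat (t.size + 1) e.1,
      Fin.ofNat (t.size + 1) e.2)) '' (t.edges 0 : Set (ℕ × ℕ)) := by
    intro e he
    induction e with
    | _ u v =>
      obtain ⟨-, h | h⟩ := (SimpleGraph.mem_edgeSet G).1 he
      · exact ⟨_, h, by simp⟩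
      · exact ⟨_, h, by simp [Sym2.eq_swap]⟩
  have h1 := (Set.ncard_le_ncard hsub ((Finset.finite_toSet _).image _)).trans
    (Set.ncard_image_le (Finset.finite_toSet _))
  rw [Set.ncard_coe_finset] at h1
  have h2 := t.card_edges_le 0
  rw [Nat.card_coe_set_eq, Nat.card_eq_fintype_card, Fintype.card_fin]
  omega

end ChordGraphs

/-! ### Labellings with prescribed rises. -/

section StepLabel

/-- The labelling starting at `1` that rises by one between `i` and `i + 1` for `i ∈ S`. -/
def stepLabel (S : Finset ℕ) (v : ℕ) : ℕ := 1 + (S.filter (· < v)).card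

theorem stepLabel_succ (S : Finset ℕ) (i : ℕ) :
    stepLabel S (i + 1) = stepLabel S i + if i ∈ S then 1 else 0 := by
  have h : S.filter (· < i + 1) = S.filter (· < i) ∪ S.filter (· = i) := by
    ext j; simp only [Finset.mem_filter, Finset.mem_union]; grind
  rw [stepLabel, h, Finset.card_union_of_disjoint, Finset.filter_eq', stepLabel, add_assoc]
  · split_ifs <;> simp
  · rw [Finset.disjoint_left]
    intro j h1 h2
    exact (Finset.mem_filter.1 h1).2.ne (Finset.mem_filter.1 h2).2

theorem stepLabel_mono (S : Finset ℕ) : Monotone (stepLabel S) :=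
  monotone_nat_of_le_succ fun i => by rw [stepLabel_succ]; omega

theorem exists_stepLabel_eq (S : Finset ℕ) {v i : ℕ} (h1 : 1 ≤ i) (h2 : i ≤ stepLabel S v) :
    ∃ w ≤ v, stepLabel S w = i := by
  induction v with
  | zero =>
    refine ⟨0, le_rfl, ?_⟩
    have : stepLabel S 0 = 1 := by simp [stepLabel]
    omega
  | succ v ih =>
    by_cases h : i ≤ stepLabel S v
    · obtain ⟨w, hw, hi⟩ := ih h
      exact ⟨w, by omega, hi⟩
    · refine ⟨v + 1, le_rfl, ?_⟩
      rw [stepLabel_succ] at h2 ⊢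
      split_ifs at * <;> omega

end StepLabel

/-! ### From walks to reachability along restricted edges. -/

namespace SimpleGraph.Walk

variable {V : Type*} {G : SimpleGraph V} {R : V → V → Prop}

theorem reflTransGen_of_forall_darts {u v : V} (p : G.Walk u v)
    (h : ∀ e ∈ p.darts, R e.fst e.snd) :
    Relation.ReflTransGen (fun x y => G.Adj x y ∧ R x y) u v := by
  induction p with
  | nil => exact .refl
  | cons hadj p ih =>
    rw [darts_cons, List.forall_mem_cons] at h
    exact (ih h.2).head ⟨hadj, h.1⟩

theorem reflTransGen_of_isPath {u v : V} (p : G.Walk u v) (hp : p.IsPath)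
    (hR : ∀ (x y : V) (q : G.Walk u y), q.IsPath → x ∈ q.support → G.Adj x y → R x y) :
    Relation.ReflTransGen (fun x y => G.Adj x y ∧ R x y) u v := by
  -- Peeling edges off the end keeps the starting point, so every prefix is a path from `u` to which
  -- `hR` applies.
  induction p using concatRec with
  | Hnil => exact .refl
  | Hconcat p hadj ih =>
    refine (ih ((concat_isPath_iff hadj).1 hp).1 hR).tail ⟨hadj, hR _ _ _ hp ?_ hadj⟩
    simp [support_concat]

end SimpleGraph.Walk

/-! ### GNC-trees as pairs of a ternary tree and a set of rises. -/

namespace GNCTree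

variable {n : ℕ}

/-- The label, extended to all natural numbers. -/
def natLabel (T : GNCTree n) (i : ℕ) : ℕ := T.label ⟨min i n, by omega⟩

theorem natLabel_of_fin (T : GNCTree n) (v : Fin (n + 1)) : T.natLabel v = T.label v := by
  rw [natLabel]
  congr
  omega

theorem natLabel_mono (T : GNCTree n) : Monotone T.natLabel := fun i j h =>
  T.label_mono (Fin.mk_le_mk.2 (by omega))

theorem natLabel_zero (T : GNCTree n) : T.natLabel 0 = 1 := by
  obtain ⟨w, hw⟩ := T.label_initial 0 1 le_rfl (T.label_pos 0)
  refine le_antisymm ?_ (T.label_pos _)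
  rw [← hw, ← T.natLabel_of_fin w]
  exact T.natLabel_mono (Nat.zero_le _)

theorem natLabel_succ_le (T : GNCTree n) (i : ℕ) : T.natLabel (i + 1) ≤ T.natLabel i + 1 := by
  by_contra! h
  obtain ⟨w, hw⟩ := T.label_initial _ (T.natLabel i + 1) (by omega) h.le
  rw [← T.natLabel_of_fin w] at hw
  rcases le_or_gt (w : ℕ) i with hi | hi
  · have := T.natLabel_mono hi; omega
  · have := T.natLabel_mono (show i + 1 ≤ w by omega); omega

/-- The positions `i < n` at which the label rises. -/
def risers (T : GNCTree n) : Finset ℕ :=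
  (Finset.range n).filter fun i => T.natLabel i ≠ T.natLabel (i + 1)

/-- Labels start at 1 and, since no value is skipped, rise by at most one, so the positions of the
rises determine them. -/
theorem natLabel_eq_stepLabel (T : GNCTree n) {i : ℕ} (hi : i ≤ n) :
    T.natLabel i = stepLabel T.risers i := by
  induction i with
  | zero => simp [T.natLabel_zero, stepLabel]
  | succ i ih =>
    have h1 := T.natLabel_succ_le i
    have h2 := T.natLabel_mono (Nat.le_succ i)
    rw [stepLabel_succ, ← ih (by omega)]
    simp only [risers, Finset.mem_filter, Finset.mem_range]
    split_ifs with h <;> rw [Nat.succ_eq_add_one] at h2 <;> omega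

theorem ext_chords_risers {T T' : GNCTree n} (h1 : T.graph.chords = T'.graph.chords)
    (h2 : T.risers = T'.risers) : T = T' := by
  refine GNCTree.ext (SimpleGraph.chords_injective h1) (funext fun v => ?_)
  rw [← T.natLabel_of_fin, ← T'.natLabel_of_fin, T.natLabel_eq_stepLabel (by omega),
    T'.natLabel_eq_stepLabel (by omega), h2]

/-- The labelled tree with underlying tree `t` and with rises at `S`. -/
def ofTernaryTree (t : TernaryTree) (S : Finset ℕ) : GNCTree t.size where
  graph := chordGraph t.size (t.edges 0)
  isTree := t.isTree_chordGraph
  nonCrossing a b c d hab hbc hcd h1 h2 := by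
    have key : ∀ {u v : Fin (t.size + 1)}, u < v → ChordAdj (t.edges 0) u v →
        ((u : ℕ), (v : ℕ)) ∈ t.edges 0 := by
      rintro u v huv (h | h)
      · exact h
      · have := TernaryTree.edges_bounds h; omega
    exact TernaryTree.edges_noncrossing hab hbc hcd (key (hab.trans hbc) h1.2)
      (key (hbc.trans hcd) h2.2)
  label v := stepLabel S v
  label_pos v := by rw [stepLabel]; omega
  label_mono u v h := stepLabel_mono S h
  label_initial v i h1 h2 := by
    obtain ⟨w, hw, hi⟩ := exists_stepLabel_eq S h1 h2
    exact ⟨⟨w, by omega⟩, hi⟩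

theorem chords_ofTernaryTree (t : TernaryTree) (S : Finset ℕ) :
    (ofTernaryTree t S).graph.chords = t.edges 0 :=
  chords_chordGraph fun h => by have := TernaryTree.edges_bounds h; omega

theorem risers_ofTernaryTree {t : TernaryTree} {S : Finset ℕ} (hS : S ⊆ Finset.range t.size) :
    (ofTernaryTree t S).risers = S := by
  ext i
  have h : ∀ j, (ofTernaryTree t S).natLabel j = stepLabel S (min j t.size) := fun _ => rfl
  rw [risers, Finset.mem_filter, Finset.mem_range, h, h]
  constructor
  · rintro ⟨h1, h2⟩
    rw [min_eq_left h1.le, min_eq_left h1, stepLabel_succ] at h2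
    by_contra hi
    exact h2 (by simp [hi])
  · intro hi
    have h1 := Finset.mem_range.1 (hS hi)
    refine ⟨h1, ?_⟩
    rw [min_eq_left h1.le, min_eq_left h1, stepLabel_succ]
    simp [hi]

theorem exists_ternaryTree (T : GNCTree n) :
    ∃ t : TernaryTree, t.size = n ∧ t.edges 0 = T.graph.chords :=
  (SimpleGraph.isChordTree_chords T.isTree T.nonCrossing).exists_ternaryTree

/-- The ternary tree of the underlying non-crossing tree. -/
noncomputable def ternaryTree (T : GNCTree n) : TernaryTree := T.exists_ternaryTree.choose

theorem size_ternaryTree (T : GNCTree n) : T.ternaryTree.size = n :=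
  T.exists_ternaryTree.choose_spec.1

theorem edges_ternaryTree (T : GNCTree n) : T.ternaryTree.edges 0 = T.graph.chords :=
  T.exists_ternaryTree.choose_spec.2

/-- `T` corresponds bijectively to its ternary tree with its set of rises. This is used with all
subsets of the free gaps (no descents) and with the empty set alone (constant labels). -/
theorem card_filter_eq_sum (P : GNCTree n → Prop) [DecidablePred P] (A : TernaryTree → Finset (Finset ℕ))
    (hA : ∀ t S, t.size = n → S ∈ A t → S ⊆ Finset.range n)
    (hP : ∀ T : GNCTree n, P T ↔ T.risers ∈ A T.ternaryTree) :
    (Finset.univ.filter P).card = ∑ t ∈ TernaryTree.ofSize n, (A t).card := by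
  rw [← Finset.card_sigma]
  refine Finset.card_bij (fun T _ => ⟨T.ternaryTree, T.risers⟩) ?_ ?_ ?_
  · intro T hT
    exact Finset.mem_sigma.2 ⟨TernaryTree.mem_ofSize.2 T.size_ternaryTree,
      (hP T).1 (Finset.mem_filter.1 hT).2⟩
  · intro T _ T' _ h
    obtain ⟨h1, h2⟩ := Sigma.mk.inj h
    refine ext_chords_risers ?_ (eq_of_heq h2)
    rw [← T.edges_ternaryTree, ← T'.edges_ternaryTree, h1]
  · rintro ⟨t, S⟩ h
    obtain ⟨h1, h2⟩ := Finset.mem_sigma.1 h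
    rw [TernaryTree.mem_ofSize] at h1
    subst h1
    have e1 : (ofTernaryTree t S).ternaryTree = t := TernaryTree.edges_injective (a := 0) (by
      rw [edges_ternaryTree, chords_ofTernaryTree])
    have e2 : (ofTernaryTree t S).risers = S := risers_ofTernaryTree (hA t S rfl h2)
    refine ⟨ofTernaryTree t S, Finset.mem_filter.2 ⟨Finset.mem_univ _, (hP _).2 ?_⟩, ?_⟩
    · rw [e1, e2]; exact h2
    · rw [e1, e2]

/-- Every point is reached from the root by a walk along which the label weakly increases. -/
def Rising (T : GNCTree n) : Prop :=
  ∀ v, Relation.ReflTransGen (fun x y => T.graph.Adj x y ∧ T.label x ≤ T.label y) 0 v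

theorem rising_iff_risingReach (T : GNCTree n) :
    T.Rising ↔ ∀ v, 0 ≤ v → v ≤ 0 + n → RisingReach T.graph.chords T.natLabel 0 v := by
  constructor
  · intro h v _ hv
    exact Relation.ReflTransGen.lift (fun x : Fin (n + 1) => (x : ℕ))
      (fun x y hxy => ⟨SimpleGraph.chordAdj_chords.2 ⟨x.2, y.2, hxy.1⟩, by
        rw [natLabel_of_fin, natLabel_of_fin]; exact hxy.2⟩) _ _ (h ⟨v, by omega⟩)
  · intro h v
    refine Relation.ReflTransGen.fin_of_nat (fun x y hxy => ?_) (h v (Nat.zero_le _) (by omega))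
      (Nat.succ_pos _) v.2
    obtain ⟨hx, hy, hadj⟩ := SimpleGraph.chordAdj_chords.1 hxy.1
    refine ⟨hx, hy, hadj, ?_⟩
    rw [← natLabel_of_fin, ← natLabel_of_fin]
    exact hxy.2

theorem rising_iff (T : GNCTree n) : T.Rising ↔ T.risers ∈ (T.ternaryTree.freeGaps 0).powerset := by
  have h := TernaryTree.forall_risingReach_iff (t := T.ternaryTree) (a := 0) T.natLabel_mono
  rw [T.edges_ternaryTree, T.size_ternaryTree] at h
  rw [rising_iff_risingReach, h, Finset.mem_powerset]
  constructor
  · intro H i hi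
    obtain ⟨h1, h2⟩ := Finset.mem_filter.1 hi
    exact H i (Nat.zero_le _) (by have := Finset.mem_range.1 h1; omega) h2
  · intro H i _ h1 h2
    exact H (Finset.mem_filter.2 ⟨Finset.mem_range.2 (by omega), h2⟩)

theorem forall_label_eq_iff (T : GNCTree n) :
    (∀ v, T.label v = T.label 0) ↔ T.risers ∈ ({∅} : Finset (Finset ℕ)) := by
  rw [Finset.mem_singleton]
  constructor
  · intro h
    rw [risers, Finset.filter_eq_empty_iff]
    intro i _
    rw [natLabel, natLabel, h, h ⟨min (i + 1) n, _⟩]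
    simp
  · intro h v
    rw [← natLabel_of_fin, ← natLabel_of_fin, T.natLabel_eq_stepLabel (by omega),
      T.natLabel_eq_stepLabel (by omega), h]
    simp [stepLabel]

/-- `Rising` only provides a walk, but shortcutting it gives the unique path from the root to `v`,
whose darts are among those of the walk. -/
theorem label_le_of_mem_darts {T : GNCTree n} (hT : T.Rising) {v : Fin (n + 1)}
    {p : T.graph.Walk 0 v} (hp : p.IsPath) {e : T.graph.Dart} (he : e ∈ p.darts) :
    T.label e.fst ≤ T.label e.snd := by
  obtain ⟨q, hq⟩ : ∃ q : T.graph.Walk 0 v, ∀ e ∈ q.darts, T.label e.fst ≤ T.label e.snd := by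
    have h := hT v
    clear he hp p
    induction h with
    | refl => exact ⟨.nil, by simp⟩
    | tail _ h ih =>
      obtain ⟨q, hq⟩ := ih
      refine ⟨q.concat h.1, fun e he => ?_⟩
      rw [SimpleGraph.Walk.darts_concat, List.concat_eq_append, List.mem_append,
        List.mem_singleton] at he
      rcases he with he | rfl
      · exact hq e he
      · exact h.2
  have hpq : p = q.bypass := (T.isTree.existsUnique_path 0 v).unique hp q.bypass_isPath
  exact hq e (q.darts_bypass_subset_darts (hpq ▸ he))

theorem ofLabels_eq_d_iff {i j : ℕ} : GNCStep.d = GNCStep.ofLabels i j ↔ j < i := by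
  rw [GNCStep.ofLabels]
  split_ifs <;> simp <;> omega

theorem avoids_d_iff (T : GNCTree n) : T.Avoids [GNCStep.d] ↔ T.Rising := by
  have key : ∀ {v} (p : T.graph.Walk 0 v), [GNCStep.d] <:+: T.word p ↔
      ∃ e ∈ p.darts, T.label e.snd < T.label e.fst := by
    intro v p
    rw [List.singleton_infix_iff, word, List.mem_map]
    exact exists_congr fun e => and_congr_right fun _ =>
      eq_comm.trans ofLabels_eq_d_iff
  constructor
  · intro h v
    obtain ⟨p, hp, -⟩ := T.isTree.existsUnique_path 0 v
    have h1 := h v p hp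
    rw [key] at h1
    push Not at h1
    exact p.reflTransGen_of_forall_darts h1
  · intro h v p hp h1
    obtain ⟨e, he, hlt⟩ := (key p).1 h1
    exact absurd (label_le_of_mem_darts h hp he) (not_le.2 hlt)

theorem reflTransGen_of_isDownEdge {T : GNCTree n} {R : Fin (n + 1) → Fin (n + 1) → Prop}
    (hR : ∀ x y, T.IsDownEdge x y → R x y) (v : Fin (n + 1)) :
    Relation.ReflTransGen (fun x y => T.graph.Adj x y ∧ R x y) 0 v := by
  obtain ⟨p, hp, -⟩ := T.isTree.existsUnique_path 0 v
  refine p.reflTransGen_of_isPath hp fun x y q hq hx hxy => hR x y ⟨hxy, q, hq, hx⟩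

/-- By uniqueness of paths, the part from `v` on of the root path to `w` is the edge itself, so that
edge is a dart of a root path. -/
theorem label_le_of_isDownEdge {T : GNCTree n} (hT : T.Rising) {v w : Fin (n + 1)}
    (h : T.IsDownEdge v w) : T.label v ≤ T.label w := by
  obtain ⟨hadj, p, hp, hv⟩ := h
  have h1 : p.dropUntil v hv = hadj.toWalk :=
    (T.isTree.existsUnique_path v w).unique (hp.dropUntil hv) (SimpleGraph.Walk.IsPath.of_adj hadj)
  refine label_le_of_mem_darts hT hp (e := ⟨(v, w), hadj⟩)
    (p.darts_dropUntil_subset_darts hv ?_)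
  rw [h1]
  simp

theorem descents_eq_zero_iff (T : GNCTree n) : T.descents = 0 ↔ T.Rising := by
  rw [descents, Set.ncard_eq_zero, Set.eq_empty_iff_forall_notMem]
  constructor
  · intro h
    exact reflTransGen_of_isDownEdge fun x y hxy => not_lt.1 fun hlt => h (x, y) ⟨hxy, hlt⟩
  · rintro h ⟨x, y⟩ ⟨hxy, hlt⟩
    exact absurd (label_le_of_isDownEdge h hxy) (not_le.2 hlt)

theorem ascents_descents_eq_zero_iff (T : GNCTree n) :
    T.ascents = 0 ∧ T.descents = 0 ↔ ∀ v, T.label v = T.label 0 := by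
  rw [ascents, descents, Set.ncard_eq_zero, Set.ncard_eq_zero, Set.eq_empty_iff_forall_notMem,
    Set.eq_empty_iff_forall_notMem]
  constructor
  · rintro ⟨h1, h2⟩ v
    have h := reflTransGen_of_isDownEdge (T := T) (R := fun x y => T.label x = T.label y)
      (fun x y hxy => le_antisymm (not_lt.1 fun hlt => h2 (x, y) ⟨hxy, hlt⟩)
        (not_lt.1 fun hlt => h1 (x, y) ⟨hxy, hlt⟩)) v
    induction h with
    | refl => rfl
    | tail _ h ih => exact h.2.symm.trans ih
  · intro h
    constructor <;> rintro ⟨x, y⟩ ⟨_, hlt⟩ <;> dsimp only at hlt <;> rw [h x, h y] at hlt <;>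
      exact lt_irrefl _ hlt

/-! ### Identification of the generating functions and conclusion. -/

open Classical in
theorem card_rising (n : ℕ) :
    ((Finset.univ.filter fun T : GNCTree n => T.Rising).card : ℤ) =
      PowerSeries.coeff n (TernaryTree.rankGenFun 2) := by
  rw [card_filter_eq_sum _ (fun t => (t.freeGaps 0).powerset) ?_ rising_iff,
    TernaryTree.rankGenFun, PowerSeries.coeff_mk]
  · simp [Finset.card_powerset, TernaryTree.card_freeGaps]
  · intro t S ht hS i hi
    have := TernaryTree.freeGaps_bounds (Finset.mem_powerset.1 hS hi)
    exact Finset.mem_range.2 (by omega)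

theorem genFun_one_one_zero : genFun 1 1 0 = TernaryTree.rankGenFun 2 := by
  classical
  ext n
  rw [← card_rising, genFun, PowerSeries.coeff_mk]
  simp [zero_pow_eq, descents_eq_zero_iff, Finset.sum_boole]

/-- With 0 ^ 0 = 1 the weight is the indicator of a constant labelling, so each non-crossing tree is
counted once. -/
theorem genFun_zero_one_zero : genFun 0 1 0 = TernaryTree.rankGenFun 1 := by
  classical
  ext n
  have h := card_filter_eq_sum (n := n) _ (fun _ => {∅})
    (fun t S _ hS => by rw [Finset.mem_singleton.1 hS]; exact Finset.empty_subset _)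
    forall_label_eq_iff
  rw [genFun, TernaryTree.rankGenFun, PowerSeries.coeff_mk, PowerSeries.coeff_mk]
  have h2 : ∀ T : GNCTree n, (0 : ℤ) ^ T.ascents * 1 ^ T.levels * 0 ^ T.descents =
      if ∀ v, T.label v = T.label 0 then 1 else 0 := by
    intro T
    rw [one_pow, mul_one, zero_pow_eq, zero_pow_eq, ← if_congr T.ascents_descents_eq_zero_iff rfl rfl]
    split_ifs <;> simp_all
  rw [Finset.sum_congr rfl fun T _ => h2 T, Finset.sum_boole, h]
  simp

end GNCTree

theorem mainTheorem4 :
    GNCTree.genFun 1 1 0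
        = PowerSeries.subst (2 * PowerSeries.X * GNCTree.genFun 0 1 0 : PowerSeries ℤ) catalanGenFun ∧
      ∀ n : ℕ,
        (Nat.card {T : GNCTree n // T.Avoids [GNCStep.d]} : ℚ)
          = ∑ p ∈ Finset.HasAntidiagonal.antidiagonal n,
              (if p.1 = 0 ∧ p.2 = 0 then (1 : ℚ) else (p.1 : ℚ) / (3 * (p.2 : ℚ) + (p.1 : ℚ)))
                * (Nat.choose (3 * p.2 + p.1) p.2 : ℚ) * 2 ^ p.1 * (catalan p.1 : ℚ) := by
  have hN : TernaryTree.rankGenFun 1 = 1 + PowerSeries.X * TernaryTree.rankGenFun 1 ^ 3 := by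
    have h := TernaryTree.rankGenFun_eq 1
    rw [map_one] at h
    linear_combination h
  have hD : TernaryTree.rankGenFun 2 = PowerSeries.subst
      (2 * PowerSeries.X * TernaryTree.rankGenFun 1 : PowerSeries ℤ) catalanGenFun := by
    apply eq_subst_catalanGenFun
    -- At x = 2 the recursion is quadratic in the unknown, with coefficient 2tN for N = `rankGenFun
    -- 1`.
    have h := TernaryTree.rankGenFun_eq 2
    rw [show (PowerSeries.C (2 : ℤ) : PowerSeries ℤ) = 2 from map_ofNat _ 2] at h
    linear_combination h
  rw [GNCTree.genFun_one_one_zero, GNCTree.genFun_zero_one_zero]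
  refine ⟨hD, fun n => ?_⟩
  classical
  rw [← coeff_subst_catalanGenFun hN, ← hD, ← GNCTree.card_rising, Int.cast_natCast,
    Nat.card_eq_fintype_card, Fintype.card_subtype]
  simp_rw [GNCTree.avoids_d_iff]
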